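/- Let $\theta\in\mathbb R$, and write $\lambda^x=e^{2\pi i\theta x}$, $\mu=\lambda^{1/2}$. Let $\Omega(S^7_{\theta'})$ be the complex graded differential algebra generated by $\psi_a,\psi_a^*$ (degree 0) and $d\psi_a,d\psi_a^*$ (degree 1), $a=1,\dots,4$, with $\psi_a\psi_b=\lambda'_{ab}\psi_b\psi_a$, $\psi_a\psi_b^*=\lambda'_{ba}\psi_b^*\psi_a$, $\psi_a^*\psi_b^*=\lambda'_{ab}\psi_b^*\psi_a^*$, the same relations when $\psi$'s are replaced by their differentials (with an extra sign $-1$ between two elements of degree 1), and the relation $\sum_a\psi_a^*\psi_a=1$ together with its differential; here $$(\lambda'_{ab})=\begin{pmatrix}1&1&\bar\mu&\mu\\1&1&\mu&\bar\mu\\ \mu&\bar\mu&1&1\\ \bar\mu&\mu&1&1\end{pmatrix}.$$ Let $\gamma_0=\mathrm{diag}(1,1,-1,-1)$, $\gamma_1=2(E_{24}+\mu E_{31})$, $\gamma_2=2(-E_{14}+\bar\mu E_{32})$ be the twisted Dirac matrices ($E_{ab}$ the matrix units), $z_\nu=\sum\psi_a^*(\gamma_\nu)_{ab}\psi_b$ and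 $\bar z_\nu=\sum\psi_a^*(\gamma_\nu^*)_{ab}\psi_b$ the coordinates of $S^4_\theta$, and $$\Psi=\begin{pmatrix}\psi_1&-\psi_2^*\\ \psi_2&\psi_1^*\\ \psi_3&-\psi_4^*\\ \psi_4&\psi_3^*\end{pmatrix},\qquad \omega=\Psi^*\,d\Psi .$$ Let $H_1=\tfrac12\mathrm{diag}(1,-1,-1,1)$ and $H_2=\tfrac12\mathrm{diag}(-1,1,-1,1)$, and let $\lambda^{uH_1+vH_2}$ also denote the algebra automorphism of $\Omega(S^7_{\theta'})$ commuting with $d$ which acts on $(\psi_a)$ by this diagonal matrix and on $(\psi_a^*)$ by its inverse. Fix $t\in\mathbb R$. The conformal generators $T=H_0,\,G_{\pm1,0},\,G_{0,\pm1}$ of $\mathcal U_\theta(so(5,1))$, with $r=(r_1,r_2)$ the index of $G_r$ and $r=(0,0)$ for $H_0$, have the coproduct $$\Delta(T)=T\otimes\lambda^{R_T}+\lambda^{L_T}\otimes T,\qquad R_T=(1-t)r_2H_1-t\,r_1H_2,\quad L_T=(1-t)r_1H_2-t\,r_2H_1,$$ that is, the primitive coproduct conjugated by the twist $\lambda^{-tH_1\otimes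 H_2+(1-t)H_2\otimes H_1}$ ($t=\tfrac12$ is the antisymmetric twist). They act on $\Omega(S^7_{\theta'})$ as linear operators commuting with $d$, satisfying $T(ab)=T(a)\lambda^{R_T}(b)+\lambda^{L_T}(a)T(b)$, and given on generators by $$\psi_a\mapsto\sum_b\Gamma_{ab}\psi_b,\qquad \psi_a^*\mapsto\sum_b(\sigma\Gamma\sigma^{-1})_{ab}\psi_b^*,\qquad \Gamma=\tfrac12\bigl(-z_T\lambda^{R_T}+\lambda^{L_T}\gamma_T\bigr),$$ where $(z_T,\gamma_T)=(z_0,\gamma_0),(z_1,\gamma_1),(z_2,\gamma_2),(\bar z_1,\gamma_1^*),(\bar z_2,\gamma_2^*)$ for $T=H_0,G_{+1,0},G_{0,+1},G_{-1,0},G_{0,-1}$, and $\sigma$ is block diagonal with two blocks $\begin{pmatrix}0&-1\\1&0\end{pmatrix}$. Then the instanton gauge potential transforms under this action as $\omega\mapsto\omega+\delta\omega_i$, where \begin{align*} \delta\omega_0&:=H_0(\omega)=-z_0\,\omega-\tfrac12\,dz_0\,\mathbb I_2+\Psi^*\gamma_0\,d\Psi,\\ \delta\omega_1&:=G_{+1,0}(\omega)=-z_1\,\omega-\tfrac12\,dz_1\,\mathbb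 I_2+\Psi^*\gamma_1\,d\Psi,\\ \delta\omega_2&:=G_{0,+1}(\omega)=-z_2\,\omega-\tfrac12\,dz_2\,\mathbb I_2+\Psi^*\gamma_2\,d\Psi,\\ \delta\omega_3&:=G_{-1,0}(\omega)=-\omega\,\bar z_1-\tfrac12\,d\bar z_1\,\mathbb I_2+\Psi^*\gamma_1^*\,d\Psi,\\ \delta\omega_4&:=G_{0,-1}(\omega)=-\omega\,\bar z_2-\tfrac12\,d\bar z_2\,\mathbb I_2+\Psi^*\gamma_2^*\,d\Psi. \end{align*} -/

import Mathlib

open Matrix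

noncomputable section

namespace ThetaSphere

/-! ## The differential calculus of the noncommutative seven-sphere -/

/-- `lam θ x` is the phase `λ ^ x`, where `λ = exp (2 π i θ)`. In particular `μ = √λ` is
`lam θ (1 / 2)`. -/
def lam (θ x : ℝ) : ℂ := Complex.exp (((2 * Real.pi * θ * x : ℝ) : ℂ) * Complex.I)

/-- Generators `ψ_a`, `ψ_a^*` (degree `0`) and `dψ_a`, `dψ_a^*` (degree `1`); the labels
`a = 1, …, 4` are `0, …, 3 : Fin 4`. -/
inductive Gen : Type
  | psi (a : Fin 4) : Gen
  | psiS (a : Fin 4) : Gen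
  | dpsi (a : Fin 4) : Gen
  | dpsiS (a : Fin 4) : Gen

/-- The label `a` of a generator. -/
def Gen.idx : Gen → Fin 4
  | .psi a => a
  | .psiS a => a
  | .dpsi a => a
  | .dpsiS a => a

/-- `+1` for `ψ_a`, `dψ_a` and `-1` for `ψ_a^*`, `dψ_a^*`. -/
def Gen.sgn : Gen → ℝ
  | .psi _ => 1
  | .psiS _ => -1
  | .dpsi _ => 1
  | .dpsiS _ => -1

/-- The form degree of a generator. -/
def Gen.deg : Gen → ℕ
  | .psi _ => 0
  | .psiS _ => 0
  | .dpsi _ => 1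
  | .dpsiS _ => 1

/-- The matrix with `θ'_{ab} = (θ / 2) * thetaM a b`, so that
`λ'_{ab} = exp (2 π i θ'_{ab}) = λ ^ (thetaM a b / 2)`. -/
def thetaM : Matrix (Fin 4) (Fin 4) ℝ :=
  !![ 0,  0, -1,  1;
      0,  0,  1, -1;
      1, -1,  0,  0;
     -1,  1,  0,  0]

/-- The coefficient in the commutation relation `x y = comCoeff x y • y x` of two generators. It is
`λ'_{ab}` for `ψ_a ψ_b` and for `ψ_a^* ψ_b^*`, it is `λ'_{ba} = (λ'_{ab})⁻¹` for `ψ_a ψ_b^*` and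
for `ψ_a^* ψ_b`, the same when some of them are replaced by their differentials, with an additional
sign `-1` when both are of degree one. -/
def comCoeff (θ : ℝ) (x y : Gen) : ℂ :=
  (-1) ^ (x.deg * y.deg) * lam θ (x.sgn * y.sgn * (thetaM x.idx y.idx / 2))

/-- The defining relations of `Ω(S^7_{θ'})`: the commutation relations, the spherical relation
`∑ ψ_a^* ψ_a = 1`, and its differential. -/
inductive Rel (θ : ℝ) : FreeAlgebra ℂ Gen → FreeAlgebra ℂ Gen → Prop
  | comm (x y : Gen) : Rel θ (FreeAlgebra.ι ℂ x * FreeAlgebra.ι ℂ y)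
      (comCoeff θ x y • (FreeAlgebra.ι ℂ y * FreeAlgebra.ι ℂ x))
  | sphere : Rel θ (∑ a, FreeAlgebra.ι ℂ (Gen.psiS a) * FreeAlgebra.ι ℂ (Gen.psi a)) 1
  | dsphere : Rel θ (∑ a, (FreeAlgebra.ι ℂ (Gen.dpsiS a) * FreeAlgebra.ι ℂ (Gen.psi a) +
      FreeAlgebra.ι ℂ (Gen.psiS a) * FreeAlgebra.ι ℂ (Gen.dpsi a))) 0

/-- The algebra `Ω(S^7_{θ'})` of polynomial differential forms; its elements of degree `0` form
`A(S^7_{θ'})`. -/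
def Omega (θ : ℝ) : Type := RingQuot (Rel θ)

instance (θ : ℝ) : Ring (Omega θ) := inferInstanceAs (Ring (RingQuot (Rel θ)))

instance (θ : ℝ) : Algebra ℂ (Omega θ) := inferInstanceAs (Algebra ℂ (RingQuot (Rel θ)))

/-- The quotient map from the free algebra. -/
def mk (θ : ℝ) : FreeAlgebra ℂ Gen →ₐ[ℂ] Omega θ := RingQuot.mkAlgHom ℂ (Rel θ)

/-- The universal property of `Ω(S^7_{θ'})`. -/
def lift (θ : ℝ) {B : Type} [Ring B] [Algebra ℂ B] (f : FreeAlgebra ℂ Gen →ₐ[ℂ] B)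
    (h : ∀ ⦃x y⦄, Rel θ x y → f x = f y) : Omega θ →ₐ[ℂ] B :=
  RingQuot.liftAlgHom ℂ ⟨f, h⟩

lemma lift_mk (θ : ℝ) {B : Type} [Ring B] [Algebra ℂ B] (f : FreeAlgebra ℂ Gen →ₐ[ℂ] B)
    (h : ∀ ⦃x y⦄, Rel θ x y → f x = f y) (x : FreeAlgebra ℂ Gen) : lift θ f h (mk θ x) = f x :=
  RingQuot.liftAlgHom_mkAlgHom_apply ℂ f h x

/-- The class of a generator in `Ω(S^7_{θ'})`. -/
def gen (θ : ℝ) (x : Gen) : Omega θ := mk θ (FreeAlgebra.ι ℂ x)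

lemma gen_comm (θ : ℝ) (x y : Gen) :
    gen θ x * gen θ y = comCoeff θ x y • (gen θ y * gen θ x) := by
  have h : mk θ _ = mk θ _ := RingQuot.mkAlgHom_rel ℂ (Rel.comm (θ := θ) x y)
  simpa [gen] using h

lemma gen_sphere (θ : ℝ) : ∑ a, gen θ (.psiS a) * gen θ (.psi a) = 1 := by
  have h : mk θ _ = mk θ _ := RingQuot.mkAlgHom_rel ℂ (Rel.sphere (θ := θ))
  simpa [gen] using h

lemma gen_dsphere (θ : ℝ) : ∑ a, (gen θ (.dpsiS a) * gen θ (.psi a) +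
    gen θ (.psiS a) * gen θ (.dpsi a)) = 0 := by
  have h : mk θ _ = mk θ _ := RingQuot.mkAlgHom_rel ℂ (Rel.dsphere (θ := θ))
  simpa [gen] using h

lemma mk_surjective (θ : ℝ) : Function.Surjective (mk θ) :=
  RingQuot.mkAlgHom_surjective ℂ (Rel θ)

/-- To prove a property of all elements of `Ω(S^7_{θ'})`. -/
lemma Omega.induct {θ : ℝ} {P : Omega θ → Prop} (hs : ∀ c : ℂ, P (algebraMap ℂ _ c))
    (hg : ∀ x, P (gen θ x)) (hm : ∀ x y, P x → P y → P (x * y))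
    (ha : ∀ x y, P x → P y → P (x + y)) (x : Omega θ) : P x := by
  obtain ⟨y, rfl⟩ := mk_surjective θ x
  induction y using FreeAlgebra.induction with
  | grade0 c => simpa using hs c
  | grade1 x => exact hg x
  | mul a b h1 h2 => simpa using hm _ _ h1 h2
  | add a b h1 h2 => simpa using ha _ _ h1 h2

lemma lam_zero (θ : ℝ) : lam θ 0 = 1 := by simp [lam]

lemma lam_add (θ x y : ℝ) : lam θ (x + y) = lam θ x * lam θ y := by
  rw [lam, lam, lam, ← Complex.exp_add]; congr 1; push_cast; ring

/-! ### Rescalings of the generators: the torus action and the grading sign -/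

/-- The algebra endomorphism of `Ω(S^7_{θ'})` which rescales every generator `x` by `s x`. -/
def rescale (θ : ℝ) (s : Gen → ℂ) (h1 : ∀ a, s (.psiS a) * s (.psi a) = 1)
    (h2 : ∃ c, ∀ a, s (.dpsiS a) * s (.psi a) = c ∧ s (.psiS a) * s (.dpsi a) = c) :
    Omega θ →ₐ[ℂ] Omega θ :=
  lift θ (FreeAlgebra.lift ℂ (fun x => s x • gen θ x)) (by
    intro x y h
    induction h with
    | comm x y =>
      simp only [map_mul, map_smul, FreeAlgebra.lift_ι_apply, smul_mul_smul_comm]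
      rw [gen_comm, smul_smul, smul_smul]
      congr 1; ring
    | sphere =>
      simp only [map_sum, map_mul, FreeAlgebra.lift_ι_apply, smul_mul_smul_comm, h1, one_smul,
        gen_sphere, map_one]
    | dsphere =>
      obtain ⟨c, hc⟩ := h2
      simp only [map_sum, map_mul, map_add, FreeAlgebra.lift_ι_apply, smul_mul_smul_comm,
        (hc _).1, (hc _).2, ← smul_add, ← Finset.smul_sum, gen_dsphere, map_zero, smul_zero])

lemma rescale_gen (θ : ℝ) (s h1 h2) (x : Gen) :
    rescale θ s h1 h2 (gen θ x) = s x • gen θ x := by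
  simp [rescale, gen, lift_mk]

/-- The eigenvalue of `H_1` on `ψ_a`. -/
def h1 : Fin 4 → ℝ := ![1 / 2, -1 / 2, -1 / 2, 1 / 2]

/-- The eigenvalue of `H_2` on `ψ_a`. -/
def h2 : Fin 4 → ℝ := ![-1 / 2, 1 / 2, -1 / 2, 1 / 2]

/-- The operator `λ ^ (u H_1 + v H_2)` on `Ω(S^7_{θ'})`: the algebra automorphism multiplying
`ψ_a`, `dψ_a` by `λ ^ (u h_1(a) + v h_2(a))` and `ψ_a^*`, `dψ_a^*` by the inverse. -/
def torus (θ u v : ℝ) : Omega θ →ₐ[ℂ] Omega θ :=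
  rescale θ (fun x => lam θ (x.sgn * (u * h1 x.idx + v * h2 x.idx)))
    (fun a => by rw [← lam_add]; simp [Gen.sgn, Gen.idx, lam_zero])
    ⟨1, fun a => by constructor <;> rw [← lam_add] <;> simp [Gen.sgn, Gen.idx, lam_zero]⟩

/-- The grading automorphism `α ↦ (-1)^p α` for `α` of form degree `p`. -/
def gradeSign (θ : ℝ) : Omega θ →ₐ[ℂ] Omega θ :=
  rescale θ (fun x => (-1) ^ x.deg) (fun a => by simp [Gen.deg])
    ⟨-1, fun a => by simp [Gen.deg]⟩

/-! ### Twisted derivations -/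

/-- For endomorphisms `L`, `R` of `Ω(S^7_{θ'})` and prescribed values `f` on the generators, the
free-algebra version of `ω ↦ !![L ω, D ω; 0, R ω]`; multiplicativity of this map is the same as
`D (a b) = L a * D b + D a * R b`. -/
def preTwisted {θ : ℝ} (L R : Omega θ →ₐ[ℂ] Omega θ) (f : Gen → Omega θ) :
    FreeAlgebra ℂ Gen →ₐ[ℂ] Matrix (Fin 2) (Fin 2) (Omega θ) :=
  FreeAlgebra.lift ℂ (fun x => !![L (gen θ x), f x; 0, R (gen θ x)])

/-- The prescribed values are compatible with the relations of `Ω(S^7_{θ'})`. -/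
def Compatible {θ : ℝ} (L R : Omega θ →ₐ[ℂ] Omega θ) (f : Gen → Omega θ) : Prop :=
  ∀ ⦃x y⦄, Rel θ x y → preTwisted L R f x = preTwisted L R f y

/-- The map `ω ↦ !![L ω, D ω; 0, R ω]` on `Ω(S^7_{θ'})`. -/
def twistedLift {θ : ℝ} (L R : Omega θ →ₐ[ℂ] Omega θ) (f : Gen → Omega θ)
    (h : Compatible L R f) : Omega θ →ₐ[ℂ] Matrix (Fin 2) (Fin 2) (Omega θ) :=
  lift θ (preTwisted L R f) h

/-- The `(L, R)`-twisted derivation `D`, that is the linear map with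
`D (a b) = D a * R b + L a * D b`, with the prescribed compatible values on the generators
(see `twistedDer_gen` and `twistedDer_mul`). -/
def twistedDer {θ : ℝ} (L R : Omega θ →ₐ[ℂ] Omega θ) (f : Gen → Omega θ)
    (h : Compatible L R f) : Omega θ →ₗ[ℂ] Omega θ :=
  Matrix.entryLinearMap ℂ (Omega θ) 0 1 ∘ₗ
    (twistedLift L R f h).toLinearMap

lemma twistedLift_gen {θ : ℝ} (L R : Omega θ →ₐ[ℂ] Omega θ) (f : Gen → Omega θ)
    (h : Compatible L R f) (x : Gen) :
    twistedLift L R f h (gen θ x) = !![L (gen θ x), f x; 0, R (gen θ x)] := by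
  simp [twistedLift, gen, preTwisted, lift_mk]

lemma twistedLift_apply {θ : ℝ} (L R : Omega θ →ₐ[ℂ] Omega θ) (f : Gen → Omega θ)
    (h : Compatible L R f) (x : Omega θ) :
    twistedLift L R f h x = !![L x, twistedDer L R f h x; 0, R x] := by
  have key : ∀ x : Omega θ, twistedLift L R f h x 0 0 = L x ∧
      twistedLift L R f h x 1 0 = 0 ∧ twistedLift L R f h x 1 1 = R x := by
    intro x
    induction x using Omega.induct with
    | hs c => simp [Matrix.algebraMap_matrix_apply]
    | hg x => simp [twistedLift_gen]
    | hm x y hx hy =>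
      simp only [map_mul, Matrix.mul_apply, Fin.sum_univ_two, hx, hy]
      simp
    | ha x y hx hy => simp [hx, hy]
  ext i j
  fin_cases i <;> fin_cases j
  · simpa using (key x).1
  · simp [twistedDer]
  · simpa using (key x).2.1
  · simpa using (key x).2.2

lemma twistedDer_gen {θ : ℝ} (L R : Omega θ →ₐ[ℂ] Omega θ) (f : Gen → Omega θ)
    (h : Compatible L R f) (x : Gen) : twistedDer L R f h (gen θ x) = f x := by
  simp [twistedDer, twistedLift_gen]

lemma twistedDer_mul {θ : ℝ} (L R : Omega θ →ₐ[ℂ] Omega θ) (f : Gen → Omega θ)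
    (h : Compatible L R f) (x y : Omega θ) : twistedDer L R f h (x * y) =
      twistedDer L R f h x * R y + L x * twistedDer L R f h y := by
  have e := congrFun (congrFun (twistedLift_apply L R f h (x * y)) 0) 1
  rw [map_mul, twistedLift_apply, twistedLift_apply, Matrix.mul_apply, Fin.sum_univ_two] at e
  simp at e
  rw [← e, add_comm]

/-- A criterion for compatibility. -/
lemma compatible_of {θ : ℝ} (L R : Omega θ →ₐ[ℂ] Omega θ) (f : Gen → Omega θ)
    (hc : ∀ x y, L (gen θ x) * f y + f x * R (gen θ y) =
      comCoeff θ x y • (L (gen θ y) * f x + f y * R (gen θ x)))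
    (hs : ∑ a, (L (gen θ (.psiS a)) * f (.psi a) + f (.psiS a) * R (gen θ (.psi a))) = 0)
    (hd : ∑ a, ((L (gen θ (.dpsiS a)) * f (.psi a) + f (.dpsiS a) * R (gen θ (.psi a))) +
      (L (gen θ (.psiS a)) * f (.dpsi a) + f (.psiS a) * R (gen θ (.dpsi a)))) = 0) :
    Compatible L R f := by
  intro x y h
  induction h with
  | comm x y =>
    have hL := congrArg L (gen_comm θ x y)
    have hR := congrArg R (gen_comm θ x y)
    simp only [map_mul, map_smul] at hL hR
    ext i j
    fin_cases i <;> fin_cases j <;> simp [preTwisted, hL, hR, hc x y]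
  | sphere =>
    have hL := congrArg L (gen_sphere θ)
    have hR := congrArg R (gen_sphere θ)
    simp only [map_sum, map_mul, map_one] at hL hR
    simp only [map_sum, map_mul, map_one]
    ext i j
    rw [Matrix.sum_apply]
    fin_cases i <;> fin_cases j <;> simp [preTwisted, hL, hR, hs]
  | dsphere =>
    have hL := congrArg L (gen_dsphere θ)
    have hR := congrArg R (gen_dsphere θ)
    simp only [map_sum, map_mul, map_add, map_zero] at hL hR
    simp only [map_sum, map_mul, map_add, map_zero]
    ext i j
    rw [Matrix.sum_apply]
    fin_cases i <;> fin_cases j <;> simp [preTwisted, hL, hR, hd]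

/-! ### Homogeneous elements -/

/-- The weight of a generator for `H_1`. -/
def Gen.w1 (x : Gen) : ℝ := x.sgn * h1 x.idx

/-- The weight of a generator for `H_2`. -/
def Gen.w2 (x : Gen) : ℝ := x.sgn * h2 x.idx

lemma thetaM_eq (a b : Fin 4) : thetaM a b / 2 = h1 a * h2 b - h2 a * h1 b := by
  fin_cases a <;> fin_cases b <;> norm_num [thetaM, h1, h2]

lemma comCoeff_eq (θ : ℝ) (x y : Gen) : comCoeff θ x y =
    (-1) ^ (x.deg * y.deg) * lam θ (x.w1 * y.w2 - x.w2 * y.w1) := by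
  rw [comCoeff, thetaM_eq]
  congr 2
  simp only [Gen.w1, Gen.w2]; ring

/-- `A` has the commutation relations with the generators of a form of weight `(r, s)` and of
degree `p`. -/
def QC (θ r s : ℝ) (p : ℕ) (A : Omega θ) : Prop :=
  ∀ x : Gen, gen θ x * A =
    ((-1) ^ (x.deg * p) * lam θ (x.w1 * s - x.w2 * r)) • (A * gen θ x)

lemma QC.gen (θ : ℝ) (x : Gen) : QC θ x.w1 x.w2 x.deg (gen θ x) := fun y => by
  rw [gen_comm, comCoeff_eq]

lemma QC.zero (θ r s : ℝ) (p : ℕ) : QC θ r s p 0 := fun y => by simp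

lemma QC.add {θ r s : ℝ} {p : ℕ} {A B : Omega θ} (hA : QC θ r s p A) (hB : QC θ r s p B) :
    QC θ r s p (A + B) := fun y => by
  rw [mul_add, hA, hB, add_mul, smul_add]

lemma QC.smul {θ r s : ℝ} {p : ℕ} {A : Omega θ} (hA : QC θ r s p A) (c : ℂ) :
    QC θ r s p (c • A) := fun y => by
  rw [mul_smul_comm, hA, smul_mul_assoc, smul_comm]

lemma QC.sum {θ r s : ℝ} {p : ℕ} {ι : Type*} (S : Finset ι) {A : ι → Omega θ}
    (hA : ∀ i ∈ S, QC θ r s p (A i)) : QC θ r s p (∑ i ∈ S, A i) := by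
  classical
  induction S using Finset.induction_on with
  | empty => simpa using QC.zero θ r s p
  | insert i S hi ih =>
    rw [Finset.sum_insert hi]
    exact (hA i (by simp)).add (ih fun j hj => hA j (by simp [hj]))

lemma QC.mul {θ r s r' s' : ℝ} {p p' : ℕ} {A B : Omega θ} (hA : QC θ r s p A)
    (hB : QC θ r' s' p' B) : QC θ (r + r') (s + s') (p + p') (A * B) := fun y => by
  rw [← mul_assoc, hA, smul_mul_assoc, mul_assoc, hB, mul_smul_comm, smul_smul, ← mul_assoc, ← mul_assoc]
  congr 1
  rw [show y.w1 * (s + s') - y.w2 * (r + r') = (y.w1 * s - y.w2 * r) + (y.w1 * s' - y.w2 * r')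
    by ring, lam_add, mul_add, pow_add]
  ring

lemma QC.congr {θ r s r' s' : ℝ} {p : ℕ} {A : Omega θ} (hA : QC θ r s p A) (h : r = r')
    (h' : s = s') : QC θ r' s' p A := by subst h h'; exact hA

lemma comm_of_QC {θ r s : ℝ} {q : ℕ} (L R : Omega θ →ₐ[ℂ] Omega θ) (f : Gen → Omega θ)
    (l k : Gen → ℂ) (hL : ∀ x, L (gen θ x) = l x • gen θ x)
    (hR : ∀ x, R (gen θ x) = k x • gen θ x)
    (hf : ∀ x, QC θ (x.w1 + r) (x.w2 + s) (x.deg + q) (f x))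
    (hlk : ∀ x, l x * ((-1) ^ (x.deg * q) * lam θ (x.w1 * s - x.w2 * r)) = k x) (x y : Gen) :
    L (gen θ x) * f y + f x * R (gen θ y) =
      comCoeff θ x y • (L (gen θ y) * f x + f y * R (gen θ x)) := by
  have key : ∀ x y : Gen, L (gen θ x) * f y = comCoeff θ x y • (f y * R (gen θ x)) := by
    intro x y
    rw [hL, hR, smul_mul_assoc, hf y x, mul_smul_comm, smul_smul, smul_smul, ← hlk x,
      comCoeff_eq]
    congr 1
    rw [show x.w1 * (y.w2 + s) - x.w2 * (y.w1 + r) =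
      (x.w1 * y.w2 - x.w2 * y.w1) + (x.w1 * s - x.w2 * r) by ring, lam_add, mul_add, pow_add]
    ring
  have hcc : comCoeff θ x y * comCoeff θ y x = 1 := by
    rw [comCoeff_eq, comCoeff_eq, mul_mul_mul_comm, ← lam_add, mul_comm y.deg, ← mul_pow]
    have : x.w1 * y.w2 - x.w2 * y.w1 + (y.w1 * x.w2 - y.w2 * x.w1) = 0 := by ring
    rw [this, lam_zero]; simp
  rw [key x y, smul_add, key y x, smul_smul, hcc, one_smul, add_comm]

/-! ### The exterior differential -/

/-- Values of the differential on the generators. -/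
def dGen (θ : ℝ) : Gen → Omega θ
  | .psi a => gen θ (.dpsi a)
  | .psiS a => gen θ (.dpsiS a)
  | .dpsi _ => 0
  | .dpsiS _ => 0

lemma gradeSign_gen (θ : ℝ) (x : Gen) : gradeSign θ (gen θ x) = (-1 : ℂ) ^ x.deg • gen θ x :=
  rescale_gen θ _ _ _ x

lemma dGen_compatible (θ : ℝ) :
    Compatible (gradeSign θ) (AlgHom.id ℂ (Omega θ)) (dGen θ) := by
  apply compatible_of
  · refine comm_of_QC (r := 0) (s := 0) (q := 1) _ _ _ (fun x => (-1) ^ x.deg) (fun _ => 1)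
      (gradeSign_gen θ) (by simp) ?_ ?_
    · intro x
      cases x with
      | psi a => simpa [dGen, Gen.w1, Gen.w2, Gen.deg, Gen.sgn, Gen.idx] using QC.gen θ (.dpsi a)
      | psiS a => simpa [dGen, Gen.w1, Gen.w2, Gen.deg, Gen.sgn, Gen.idx] using QC.gen θ (.dpsiS a)
      | dpsi a => exact QC.zero θ _ _ _
      | dpsiS a => exact QC.zero θ _ _ _
    · intro x
      simp [lam_zero, ← mul_pow]
  · have h := gen_dsphere θ
    simp only [gradeSign_gen, Gen.deg, dGen, pow_zero, one_smul, AlgHom.id_apply] at *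
    rw [← h]
    exact Finset.sum_congr rfl fun a _ => add_comm _ _
  · simp [gradeSign_gen, Gen.deg, dGen]

/-- The exterior differential of `Ω(S^7_{θ'})`: the graded derivation with `ψ_a ↦ dψ_a`,
`ψ_a^* ↦ dψ_a^*`, `dψ_a ↦ 0`, `dψ_a^* ↦ 0`. -/
def d (θ : ℝ) : Omega θ →ₗ[ℂ] Omega θ :=
  twistedDer (gradeSign θ) (AlgHom.id ℂ (Omega θ)) (dGen θ) (dGen_compatible θ)

lemma d_gen (θ : ℝ) (x : Gen) : d θ (gen θ x) = dGen θ x := twistedDer_gen ..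

/-- The graded Leibniz rule. -/
lemma d_mul (θ : ℝ) (x y : Omega θ) : d θ (x * y) = d θ x * y + gradeSign θ x * d θ y :=
  twistedDer_mul ..

lemma QC.d {θ r s : ℝ} {A : Omega θ} (hA : QC θ r s 0 A) (hA' : gradeSign θ A = A) :
    QC θ r s 1 (d θ A) := by
  intro x
  have h0 := congrArg (ThetaSphere.d θ) (hA x)
  rw [map_smul, d_mul, d_mul, hA', d_gen, gradeSign_gen] at h0
  cases x with
  | psi a =>
    have h1 := hA (.dpsi a)
    simp only [dGen, Gen.deg, Gen.w1, Gen.w2, Gen.sgn, Gen.idx, pow_zero, one_smul, mul_zero,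
      zero_mul, one_mul, smul_add] at *
    rw [h1, add_comm] at h0
    exact add_right_cancel h0
  | psiS a =>
    have h1 := hA (.dpsiS a)
    simp only [dGen, Gen.deg, Gen.w1, Gen.w2, Gen.sgn, Gen.idx, pow_zero, one_smul, mul_zero,
      zero_mul, one_mul, smul_add] at *
    rw [h1, add_comm] at h0
    exact add_right_cancel h0
  | dpsi a =>
    simp [dGen, Gen.deg, Gen.w1, Gen.w2, Gen.sgn, Gen.idx] at *
    rw [← h0, neg_neg]
  | dpsiS a =>
    simp [dGen, Gen.deg, Gen.w1, Gen.w2, Gen.sgn, Gen.idx] at *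
    rw [← h0, neg_neg]

lemma gradeSign_psi (θ : ℝ) (a : Fin 4) : gradeSign θ (gen θ (.psi a)) = gen θ (.psi a) := by
  simp [gradeSign_gen, Gen.deg]

lemma gradeSign_psiS (θ : ℝ) (a : Fin 4) :
    gradeSign θ (gen θ (.psiS a)) = gen θ (.psiS a) := by
  simp [gradeSign_gen, Gen.deg]

/-! ## The twisted Dirac matrices and the instanton gauge potential -/

/-- The twisted Dirac matrices `γ_0`, `γ_1`, `γ_2`; here `μ = lam θ (1 / 2)` and
`μ̄ = lam θ (-1 / 2)`. -/
def gamma (θ : ℝ) : Fin 3 → Matrix (Fin 4) (Fin 4) ℂ :=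
  ![!![1, 0, 0, 0;
       0, 1, 0, 0;
       0, 0, -1, 0;
       0, 0, 0, -1],
    (2 : ℂ) • !![0, 0, 0, 0;
                 0, 0, 0, 1;
                 lam θ (1 / 2), 0, 0, 0;
                 0, 0, 0, 0],
    (2 : ℂ) • !![0, 0, 0, -1;
                 0, 0, 0, 0;
                 0, lam θ (-1 / 2), 0, 0;
                 0, 0, 0, 0]]

/-- The element `∑ ψ_a^* A_{ab} ψ_b`. -/
def quad (θ : ℝ) (A : Matrix (Fin 4) (Fin 4) ℂ) : Omega θ :=
  ∑ a, ∑ b, A a b • (gen θ (.psiS a) * gen θ (.psi b))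

/-- The coordinates `z_0`, `z_1`, `z_2` of the four-sphere, `z_μ = ∑ ψ_a^* (γ_μ)_{ab} ψ_b`. -/
def z (θ : ℝ) (i : Fin 3) : Omega θ := quad θ (gamma θ i)

/-- The conjugate coordinates `z_μ^* = ∑ ψ_a^* (γ_μ^*)_{ab} ψ_b`. -/
def zS (θ : ℝ) (i : Fin 3) : Omega θ := quad θ (gamma θ i)ᴴ

/-- A complex matrix as a matrix with entries in `Ω(S^7_{θ'})`. -/
def toOmega (θ : ℝ) {m n : Type} (A : Matrix m n ℂ) : Matrix m n (Omega θ) :=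
  A.map (algebraMap ℂ (Omega θ))

/-- The matrix `Ψ`, with columns `(ψ_1, ψ_2, ψ_3, ψ_4)` and `(-ψ_2^*, ψ_1^*, -ψ_4^*, ψ_3^*)`. -/
def Psi (θ : ℝ) : Matrix (Fin 4) (Fin 2) (Omega θ) :=
  !![gen θ (.psi 0), -gen θ (.psiS 1);
     gen θ (.psi 1), gen θ (.psiS 0);
     gen θ (.psi 2), -gen θ (.psiS 3);
     gen θ (.psi 3), gen θ (.psiS 2)]

/-- The adjoint matrix `Ψ^*`. -/
def PsiS (θ : ℝ) : Matrix (Fin 2) (Fin 4) (Omega θ) :=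
  !![gen θ (.psiS 0), gen θ (.psiS 1), gen θ (.psiS 2), gen θ (.psiS 3);
     -gen θ (.psi 1), gen θ (.psi 0), -gen θ (.psi 3), gen θ (.psi 2)]

/-- The matrix of one-forms `dΨ`. -/
def dPsi (θ : ℝ) : Matrix (Fin 4) (Fin 2) (Omega θ) := (Psi θ).map (d θ)

/-- The instanton gauge potential `ω = Ψ^* dΨ`. -/
def omega (θ : ℝ) : Matrix (Fin 2) (Fin 2) (Omega θ) := PsiS θ * dPsi θ

/-! ## The twisted conformal action -/

/-- The generators `H_0`, `G_{+1,0}`, `G_{0,+1}`, `G_{-1,0}`, `G_{0,-1}` which together with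
`so(5)` span the conformal Lie algebra `so(5,1)`. -/
inductive ConfGen : Type
  | H0 : ConfGen
  | Gp1 : ConfGen
  | Gp2 : ConfGen
  | Gm1 : ConfGen
  | Gm2 : ConfGen

/-- The root `r = (r_1, r_2)` of a generator: `[H_j, T] = r_j T`. -/
def ConfGen.root : ConfGen → ℝ × ℝ
  | .H0 => (0, 0)
  | .Gp1 => (1, 0)
  | .Gp2 => (0, 1)
  | .Gm1 => (-1, 0)
  | .Gm2 => (0, -1)

/-- The Dirac matrix which belongs to a generator: `γ_0`, `γ_1`, `γ_2`, `γ_1^*`, `γ_2^*`. -/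
def ConfGen.dirac (θ : ℝ) : ConfGen → Matrix (Fin 4) (Fin 4) ℂ
  | .H0 => gamma θ 0
  | .Gp1 => gamma θ 1
  | .Gp2 => gamma θ 2
  | .Gm1 => (gamma θ 1)ᴴ
  | .Gm2 => (gamma θ 2)ᴴ

/-- The coordinate which belongs to a generator: `z_0`, `z_1`, `z_2`, `z_1^*`, `z_2^*`. -/
def ConfGen.coord (θ : ℝ) : ConfGen → Omega θ
  | .H0 => z θ 0
  | .Gp1 => z θ 1
  | .Gp2 => z θ 2
  | .Gm1 => zS θ 1
  | .Gm2 => zS θ 2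

/-- The exponents `(u, v)` of the left leg `λ ^ (u H_1 + v H_2)` in the twisted coproduct
`Δ(T) = T ⊗ λ ^ (u' H_1 + v' H_2) + λ ^ (u H_1 + v H_2) ⊗ T`, where `Δ` is obtained from the
primitive coproduct by conjugation with the twist `λ ^ (-t H_1 ⊗ H_2 + (1 - t) H_2 ⊗ H_1)`.
For `t = 1 / 2` this is the antisymmetric twist, with
`Δ(G_r) = G_r ⊗ λ ^ ((-r_1 H_2 + r_2 H_1) / 2) + λ ^ ((r_1 H_2 - r_2 H_1) / 2) ⊗ G_r`;
for `t = 1` it is `Δ(G_r) = G_r ⊗ λ ^ (-r_1 H_2) + λ ^ (-r_2 H_1) ⊗ G_r`. -/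
def ConfGen.legL (t : ℝ) (T : ConfGen) : ℝ × ℝ := (-t * T.root.2, (1 - t) * T.root.1)

/-- The exponents `(u', v')` of the right leg in the twisted coproduct. -/
def ConfGen.legR (t : ℝ) (T : ConfGen) : ℝ × ℝ := ((1 - t) * T.root.2, -t * T.root.1)

/-- The matrix of `λ ^ (u H_1 + v H_2)` in the spin representation. -/
def spinTorus (θ u v : ℝ) : Matrix (Fin 4) (Fin 4) ℂ :=
  Matrix.diagonal fun a => lam θ (u * h1 a + v * h2 a)

/-- The matrix `Γ` through which a generator `T` acts on `(ψ_1, …, ψ_4)`. With the legs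
`λ ^ L`, `λ ^ R` of the twisted coproduct of `T` it is `(1 / 2) (-z_T λ ^ R + λ ^ L γ_T)`.
For `t = 1` this is `H_0 = (1 / 2) (-z_0 + γ_0)`, `G_{1,0} = (1 / 2) (-z_1 λ ^ (-H_2) + γ_1)`,
`G_{0,1} = (1 / 2) (-z_2 + λ ^ (-H_1) γ_2)`, and `G_{-r}` is the adjoint of `G_r`. -/
def Gam (θ t : ℝ) (T : ConfGen) : Matrix (Fin 4) (Fin 4) (Omega θ) :=
  (1 / 2 : ℂ) • (-(T.coord θ • toOmega θ (spinTorus θ (T.legR t).1 (T.legR t).2)) +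
    toOmega θ (spinTorus θ (T.legL t).1 (T.legL t).2 * T.dirac θ))

/-- The matrix `σ`. -/
def sigma : Matrix (Fin 4) (Fin 4) ℂ :=
  !![0, -1, 0, 0;
     1, 0, 0, 0;
     0, 0, 0, -1;
     0, 0, 1, 0]

/-- The matrix `σ Γ σ⁻¹` through which a generator acts on `(ψ_1^*, …, ψ_4^*)`. -/
def GamTilde (θ t : ℝ) (T : ConfGen) : Matrix (Fin 4) (Fin 4) (Omega θ) :=
  toOmega θ sigma * Gam θ t T * toOmega θ sigma⁻¹

/-- The values of the twisted action on the generators: `ψ_a ↦ ∑ Γ_{ab} ψ_b`,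
`ψ_a^* ↦ ∑ (σ Γ σ⁻¹)_{ab} ψ_b^*`, and the differentials of these. -/
def actGen (θ t : ℝ) (T : ConfGen) : Gen → Omega θ
  | .psi a => ∑ b, Gam θ t T a b * gen θ (.psi b)
  | .psiS a => ∑ b, GamTilde θ t T a b * gen θ (.psiS b)
  | .dpsi a => d θ (∑ b, Gam θ t T a b * gen θ (.psi b))
  | .dpsiS a => d θ (∑ b, GamTilde θ t T a b * gen θ (.psiS b))

/-! ### Compatibility of the twisted action with the relations -/

/-- The permutation of the labels under conjugation with `σ`. -/
def flip : Fin 4 → Fin 4 := ![1, 0, 3, 2]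

/-- The signs under conjugation with `σ`. -/
def flipSign : Fin 4 → ℂ := ![1, -1, 1, -1]

lemma sigma_inv : sigma⁻¹ = -sigma := by
  apply Matrix.inv_eq_right_inv
  ext i j
  fin_cases i <;> fin_cases j <;> simp [sigma, Matrix.mul_apply, Fin.sum_univ_four]

lemma sigma_conj (A : Matrix (Fin 4) (Fin 4) ℂ) (a b : Fin 4) :
    (sigma * A * sigma⁻¹) a b = flipSign a * flipSign b * A (flip a) (flip b) := by
  rw [sigma_inv]
  fin_cases a <;> fin_cases b <;>
    simp [sigma, Matrix.mul_apply, Fin.sum_univ_four, flip, flipSign, -Matrix.cons_mul]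

lemma h1_flip (a : Fin 4) : h1 (flip a) = -h1 a := by
  fin_cases a <;> simp [h1, flip] <;> norm_num

lemma h2_flip (a : Fin 4) : h2 (flip a) = -h2 a := by
  fin_cases a <;> simp [h2, flip] <;> norm_num

lemma flip_flip (a : Fin 4) : flip (flip a) = a := by
  fin_cases a <;> rfl

lemma flip_injective : Function.Injective flip := fun a b h => by
  rw [← flip_flip a, h, flip_flip]

lemma flipSign_mul_self (a : Fin 4) : flipSign a * flipSign a = 1 := by
  fin_cases a <;> simp [flipSign]

lemma star_lam (θ x : ℝ) : star (lam θ x) = lam θ (-x) := by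
  rw [lam, lam, Complex.star_def, ← Complex.exp_conj, map_mul, Complex.conj_ofReal, Complex.conj_I]
  congr 1; push_cast; ring

lemma conj_lam (θ x : ℝ) : (starRingEnd ℂ) (lam θ x) = lam θ (-x) := star_lam θ x

lemma coord_eq (θ : ℝ) (T : ConfGen) : T.coord θ = quad θ (T.dirac θ) := by
  cases T <;> rfl

lemma dirac_support (θ : ℝ) (T : ConfGen) (a b : Fin 4) : T.dirac θ a b = 0 ∨
    (h1 b = h1 a + T.root.1 ∧ h2 b = h2 a + T.root.2) := by
  cases T <;> fin_cases a <;> fin_cases b <;>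
    simp [ConfGen.dirac, gamma, h1, h2, ConfGen.root] <;> norm_num

lemma dirac_flip (θ : ℝ) (T : ConfGen) (a b : Fin 4) :
    flipSign a * flipSign b * T.dirac θ (flip a) (flip b) *
      lam θ (T.root.2 * h1 a - T.root.1 * h2 a) = T.dirac θ b a := by
  cases T <;> fin_cases a <;> fin_cases b <;>
    simp [ConfGen.dirac, gamma, h1, h2, ConfGen.root, flip, flipSign, lam_zero, conj_lam,
      mul_assoc, ← lam_add] <;> norm_num [lam_zero]

lemma quad_eq_sum (θ : ℝ) (A : Matrix (Fin 4) (Fin 4) ℂ) :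
    quad θ A = ∑ a, ∑ b, A a b • (gen θ (.psiS a) * gen θ (.psi b)) := rfl

lemma QC_coord (θ : ℝ) (T : ConfGen) : QC θ T.root.1 T.root.2 0 (T.coord θ) := by
  rw [coord_eq]
  refine QC.sum _ fun a _ => QC.sum _ fun b _ => ?_
  rcases dirac_support θ T a b with h | ⟨h, h'⟩
  · rw [h, zero_smul]; exact QC.zero θ _ _ _
  · refine (((QC.gen θ (.psiS a)).mul (QC.gen θ (.psi b))).smul _).congr ?_ ?_ <;>
      simp [Gen.w1, Gen.w2, Gen.sgn, Gen.idx, h, h']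

lemma gradeSign_coord (θ : ℝ) (T : ConfGen) : gradeSign θ (T.coord θ) = T.coord θ := by
  simp [coord_eq, quad, gradeSign_gen, Gen.deg]

lemma sum_diag_smul (θ : ℝ) (c k l : ℂ) (A : Omega θ) (B : Fin 4 → ℂ) (g : Fin 4 → Omega θ)
    (a : Fin 4) (M : Fin 4 → Omega θ)
    (hM : ∀ b, M b = c • (-(A * algebraMap ℂ (Omega θ) (if a = b then k else 0)) +
      algebraMap ℂ (Omega θ) (l * B b))) :
    ∑ b, M b * g b = (-c * k) • (A * g a) + ∑ b, (c * (l * B b)) • g b := by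
  have : ∀ b, M b * g b = (if a = b then (-c * k) • (A * g a) else 0) +
      (c * (l * B b)) • g b := by
    intro b
    rw [hM, smul_mul_assoc, add_mul, smul_add, ← Algebra.smul_def, smul_smul, neg_mul, smul_neg]
    congr 1
    split_ifs with h
    · subst h
      rw [← Algebra.commutes, mul_assoc, ← Algebra.smul_def, smul_smul, neg_mul, neg_smul]
    · simp
  simp only [this, Finset.sum_add_distrib, Finset.sum_ite_eq, Finset.mem_univ, if_true]

lemma Gam_apply (θ t : ℝ) (T : ConfGen) (a b : Fin 4) : Gam θ t T a b =
    (1 / 2 : ℂ) • (-(T.coord θ * algebraMap ℂ (Omega θ)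
      (if a = b then lam θ ((T.legR t).1 * h1 a + (T.legR t).2 * h2 a) else 0)) +
    algebraMap ℂ (Omega θ)
      (lam θ ((T.legL t).1 * h1 a + (T.legL t).2 * h2 a) * T.dirac θ a b)) := by
  simp only [Gam, toOmega, spinTorus, Matrix.smul_apply, Matrix.add_apply, Matrix.neg_apply,
    Matrix.map_apply, Matrix.diagonal_apply, Matrix.diagonal_mul, smul_eq_mul]

lemma sigma_conj_omega (θ : ℝ) (A : Matrix (Fin 4) (Fin 4) (Omega θ)) (a b : Fin 4) :
    (toOmega θ sigma * A * toOmega θ sigma⁻¹) a b =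
      (flipSign a * flipSign b) • A (flip a) (flip b) := by
  rw [sigma_inv]
  fin_cases a <;> fin_cases b <;>
    simp [sigma, toOmega, Matrix.mul_apply, Fin.sum_univ_four, flip, flipSign, -Matrix.cons_mul]

lemma actGen_psi (θ t : ℝ) (T : ConfGen) (a : Fin 4) : actGen θ t T (.psi a) =
    (-(1 / 2) * lam θ ((T.legR t).1 * h1 a + (T.legR t).2 * h2 a)) •
      (T.coord θ * gen θ (.psi a)) +
    ∑ b, (1 / 2 * (lam θ ((T.legL t).1 * h1 a + (T.legL t).2 * h2 a) * T.dirac θ a b)) •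
      gen θ (.psi b) :=
  sum_diag_smul θ _ _ _ _ _ (fun b => gen θ (.psi b)) a _ (Gam_apply θ t T a)

lemma actGen_psiS (θ t : ℝ) (T : ConfGen) (a : Fin 4) : actGen θ t T (.psiS a) =
    (-(1 / 2) * lam θ (-((T.legR t).1 * h1 a + (T.legR t).2 * h2 a))) •
      (T.coord θ * gen θ (.psiS a)) +
    ∑ b, (1 / 2 * (lam θ (-((T.legL t).1 * h1 a + (T.legL t).2 * h2 a)) *
      (flipSign a * flipSign b * T.dirac θ (flip a) (flip b)))) • gen θ (.psiS b) := by
  refine sum_diag_smul θ _ _ _ _ _ (fun b => gen θ (.psiS b)) a _ fun b => ?_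
  rw [GamTilde, sigma_conj_omega, Gam_apply, smul_comm, smul_add, smul_neg]
  have e : ∀ u v : ℝ, u * h1 (flip a) + v * h2 (flip a) = -(u * h1 a + v * h2 a) := by
    intro u v; rw [h1_flip, h2_flip]; ring
  have hs : ∀ c k : ℂ, c • algebraMap ℂ (Omega θ) k = algebraMap ℂ (Omega θ) (c * k) := by
    intro c k; rw [map_mul, Algebra.smul_def]
  rw [e, e, ← mul_smul_comm, hs, hs]
  congr 3
  · congr 2
    by_cases h : a = b
    · subst h; simp [flipSign_mul_self]
    · simp [h, flip_injective.ne h]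
  · ring

lemma QC_actGen (θ t : ℝ) (T : ConfGen) (x : Gen) :
    QC θ (x.w1 + T.root.1) (x.w2 + T.root.2) x.deg (actGen θ t T x) ∧
      (x.deg = 0 → gradeSign θ (actGen θ t T x) = actGen θ t T x) := by
  have hpsi : ∀ a, QC θ ((Gen.psi a).w1 + T.root.1) ((Gen.psi a).w2 + T.root.2) 0
      (actGen θ t T (.psi a)) := by
    intro a
    rw [actGen_psi]
    refine ((((QC_coord θ T).mul (QC.gen θ (.psi a))).smul _).congr (add_comm _ _)
      (add_comm _ _)).add (QC.sum _ fun b _ => ?_)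
    rcases dirac_support θ T a b with h | ⟨h, h'⟩
    · rw [h, mul_zero, mul_zero, zero_smul]; exact QC.zero θ _ _ _
    · refine ((QC.gen θ (.psi b)).smul _).congr ?_ ?_ <;>
        simp [Gen.w1, Gen.w2, Gen.sgn, Gen.idx, h, h']
  have hpsiS : ∀ a, QC θ ((Gen.psiS a).w1 + T.root.1) ((Gen.psiS a).w2 + T.root.2) 0
      (actGen θ t T (.psiS a)) := by
    intro a
    rw [actGen_psiS]
    refine ((((QC_coord θ T).mul (QC.gen θ (.psiS a))).smul _).congr (add_comm _ _)
      (add_comm _ _)).add (QC.sum _ fun b _ => ?_)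
    rcases dirac_support θ T (flip a) (flip b) with h | ⟨h, h'⟩
    · rw [h, mul_zero, mul_zero, mul_zero, zero_smul]; exact QC.zero θ _ _ _
    · rw [h1_flip, h1_flip] at h
      rw [h2_flip, h2_flip] at h'
      refine ((QC.gen θ (.psiS b)).smul _).congr ?_ ?_ <;>
        simp [Gen.w1, Gen.w2, Gen.sgn, Gen.idx, h, h']
  have gpsi : ∀ a, gradeSign θ (actGen θ t T (.psi a)) = actGen θ t T (.psi a) := by
    intro a
    rw [actGen_psi]
    simp [gradeSign_coord, gradeSign_psi]
  have gpsiS : ∀ a, gradeSign θ (actGen θ t T (.psiS a)) = actGen θ t T (.psiS a) := by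
    intro a
    rw [actGen_psiS]
    simp [gradeSign_coord, gradeSign_psiS]
  cases x with
  | psi a => exact ⟨hpsi a, fun _ => gpsi a⟩
  | psiS a => exact ⟨hpsiS a, fun _ => gpsiS a⟩
  | dpsi a => exact ⟨(hpsi a).d (gpsi a), fun h => absurd h one_ne_zero⟩
  | dpsiS a => exact ⟨(hpsiS a).d (gpsiS a), fun h => absurd h one_ne_zero⟩

lemma torus_gen (θ u v : ℝ) (x : Gen) :
    torus θ u v (gen θ x) = lam θ (x.sgn * (u * h1 x.idx + v * h2 x.idx)) • gen θ x :=
  rescale_gen θ _ _ _ x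

lemma act_sphere (θ t : ℝ) (T : ConfGen) :
    ∑ a, (torus θ (T.legL t).1 (T.legL t).2 (gen θ (.psiS a)) * actGen θ t T (.psi a) +
      actGen θ t T (.psiS a) * torus θ (T.legR t).1 (T.legR t).2 (gen θ (.psi a))) = 0 := by
  have e1 : ∑ a, torus θ (T.legL t).1 (T.legL t).2 (gen θ (.psiS a)) * actGen θ t T (.psi a) =
      0 := by
    have : ∀ a, torus θ (T.legL t).1 (T.legL t).2 (gen θ (.psiS a)) * actGen θ t T (.psi a) =
        (-(1 / 2) : ℂ) • (T.coord θ * (gen θ (.psiS a) * gen θ (.psi a))) +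
        (1 / 2 : ℂ) • ∑ b, T.dirac θ a b • (gen θ (.psiS a) * gen θ (.psi b)) := by
      intro a
      rw [torus_gen, actGen_psi, mul_add, smul_mul_smul_comm, ← mul_assoc (gen θ _),
        QC_coord θ T (.psiS a), smul_mul_assoc, smul_smul, mul_assoc (T.coord θ),
        Finset.mul_sum, Finset.smul_sum]
      congr 1
      · congr 1
        rw [mul_zero, pow_zero, one_mul]
        rw [mul_left_comm, mul_assoc, ← lam_add, ← lam_add]
        refine (congrArg (fun x => -(1 / 2) * lam θ x) (?_ : _ = (0 : ℝ))).trans (by simp [lam_zero])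
        simp only [Gen.w1, Gen.w2, Gen.sgn, Gen.idx, ConfGen.legL, ConfGen.legR]
        ring
      · refine Finset.sum_congr rfl fun b _ => ?_
        rw [smul_mul_smul_comm, smul_smul]
        congr 1
        rw [mul_left_comm, ← mul_assoc (lam θ _), ← lam_add]
        simp [Gen.sgn, Gen.idx, lam_zero]
    rw [Finset.sum_congr rfl fun a _ => this a, Finset.sum_add_distrib, ← Finset.smul_sum,
      ← Finset.smul_sum, ← Finset.mul_sum, gen_sphere, mul_one, coord_eq, quad_eq_sum, ← add_smul]
    simp
  have e2 : ∑ a, actGen θ t T (.psiS a) * torus θ (T.legR t).1 (T.legR t).2 (gen θ (.psi a)) =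
      0 := by
    have : ∀ a, actGen θ t T (.psiS a) * torus θ (T.legR t).1 (T.legR t).2 (gen θ (.psi a)) =
        (-(1 / 2) : ℂ) • (T.coord θ * (gen θ (.psiS a) * gen θ (.psi a))) +
        (1 / 2 : ℂ) • ∑ b, T.dirac θ b a • (gen θ (.psiS b) * gen θ (.psi a)) := by
      intro a
      rw [torus_gen, actGen_psiS, add_mul, smul_mul_smul_comm, mul_assoc (T.coord θ), Finset.sum_mul,
        Finset.smul_sum]
      congr 1
      · congr 1
        rw [mul_assoc (-(1 / 2) : ℂ), ← lam_add]
        simp [Gen.sgn, Gen.idx, lam_zero]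
      · refine Finset.sum_congr rfl fun b _ => ?_
        rw [smul_mul_assoc, mul_smul_comm, smul_smul, smul_smul, ← dirac_flip θ T a b,
          show T.root.2 * h1 a - T.root.1 * h2 a =
            -((T.legL t).1 * h1 a + (T.legL t).2 * h2 a) + (Gen.psi a).sgn *
              ((T.legR t).1 * h1 (Gen.psi a).idx + (T.legR t).2 * h2 (Gen.psi a).idx) by
            simp only [Gen.sgn, Gen.idx, ConfGen.legL, ConfGen.legR]; ring, lam_add]
        congr 1
        ring
    rw [Finset.sum_congr rfl fun a _ => this a, Finset.sum_add_distrib, ← Finset.smul_sum,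
      ← Finset.smul_sum, ← Finset.mul_sum, gen_sphere, mul_one, coord_eq, quad_eq_sum,
      Finset.sum_comm, ← add_smul]
    simp
  rw [Finset.sum_add_distrib, e1, e2, add_zero]

lemma actGen_compatible (θ t : ℝ) (T : ConfGen) :
    Compatible (torus θ (T.legL t).1 (T.legL t).2) (torus θ (T.legR t).1 (T.legR t).2)
      (actGen θ t T) := by
  apply compatible_of
  · refine comm_of_QC (r := T.root.1) (s := T.root.2) (q := 0) _ _ _ _ _ (torus_gen θ _ _)
      (torus_gen θ _ _) (fun x => (QC_actGen θ t T x).1) fun x => ?_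
    rw [mul_zero, pow_zero, one_mul, ← lam_add]
    congr 1
    simp only [Gen.w1, Gen.w2, ConfGen.legL, ConfGen.legR]
    ring
  · exact act_sphere θ t T
  · have h := congrArg (d θ) (act_sphere θ t T)
    rw [map_zero, map_sum] at h
    rw [← h]
    refine Finset.sum_congr rfl fun a _ => ?_
    rw [map_add, d_mul, d_mul, (QC_actGen θ t T (.psiS a)).2 rfl]
    simp only [torus_gen, map_smul, gradeSign_psiS, d_gen, dGen]
    simp only [actGen, Gen.sgn, Gen.idx]
    abel

/-- The twisted action of a generator `T` of `U_θ(so(5,1))` on `Ω(S^7_{θ'})`: the linear operator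
with the values `actGen` on the generators and with
`T (a b) = T a * λ ^ R b + λ ^ L a * T b` for the twisted coproduct
`Δ(T) = T ⊗ λ ^ R + λ ^ L ⊗ T`; it commutes with the differential. -/
def act (θ t : ℝ) (T : ConfGen) : Omega θ →ₗ[ℂ] Omega θ :=
  twistedDer (torus θ (T.legL t).1 (T.legL t).2) (torus θ (T.legR t).1 (T.legR t).2)
    (actGen θ t T) (actGen_compatible θ t T)

lemma act_gen (θ t : ℝ) (T : ConfGen) (x : Gen) : act θ t T (gen θ x) = actGen θ t T x :=
  twistedDer_gen ..

lemma act_mul (θ t : ℝ) (T : ConfGen) (x y : Omega θ) : act θ t T (x * y) =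
    act θ t T x * torus θ (T.legR t).1 (T.legR t).2 y +
      torus θ (T.legL t).1 (T.legL t).2 x * act θ t T y :=
  twistedDer_mul ..

lemma twistedDer_algebraMap {θ : ℝ} (L R : Omega θ →ₐ[ℂ] Omega θ) (f : Gen → Omega θ)
    (h : Compatible L R f) (c : ℂ) : twistedDer L R f h (algebraMap ℂ _ c) = 0 := by
  have e := congrFun (congrFun (twistedLift_apply L R f h (algebraMap ℂ _ c)) 0) 1
  rw [AlgHom.commutes, Matrix.algebraMap_matrix_apply] at e
  simpa using e.symm

lemma d_gradeSign (θ : ℝ) (x : Omega θ) : d θ (gradeSign θ x) = -gradeSign θ (d θ x) := by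
  induction x using Omega.induct with
  | hs c => rw [AlgHom.commutes, d, twistedDer_algebraMap]; simp
  | hg x => cases x <;> simp [gradeSign_gen, d_gen, dGen, Gen.deg]
  | hm x y hx hy => simp only [map_mul, d_mul, map_add, hx, hy]; noncomm_ring
  | ha x y hx hy => simp only [map_add, hx, hy]; abel

/-- The differential squares to zero. -/
lemma d_d (θ : ℝ) (x : Omega θ) : d θ (d θ x) = 0 := by
  induction x using Omega.induct with
  | hs c => rw [d, twistedDer_algebraMap, map_zero]
  | hg x => cases x <;> simp [d_gen, dGen]
  | hm x y hx hy => simp only [d_mul, map_add, hx, hy, d_gradeSign]; simp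
  | ha x y hx hy => simp only [map_add, hx, hy, add_zero]

lemma torus_gradeSign (θ u v : ℝ) (x : Omega θ) :
    torus θ u v (gradeSign θ x) = gradeSign θ (torus θ u v x) := by
  induction x using Omega.induct with
  | hs c => simp only [AlgHom.commutes]
  | hg x => rw [gradeSign_gen, torus_gen, map_smul, map_smul, gradeSign_gen, torus_gen, smul_comm]
  | hm x y hx hy => simp only [map_mul, hx, hy]
  | ha x y hx hy => simp only [map_add, hx, hy]

lemma torus_d (θ u v : ℝ) (x : Omega θ) : torus θ u v (d θ x) = d θ (torus θ u v x) := by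
  induction x using Omega.induct with
  | hs c => rw [AlgHom.commutes, d, twistedDer_algebraMap, map_zero]
  | hg x => cases x <;> simp [d_gen, dGen, torus_gen, Gen.sgn, Gen.idx]
  | hm x y hx hy => simp only [map_mul, d_mul, map_add, hx, hy, torus_gradeSign]
  | ha x y hx hy => simp only [map_add, hx, hy]

lemma act_gradeSign (θ t : ℝ) (T : ConfGen) (x : Omega θ) :
    act θ t T (gradeSign θ x) = gradeSign θ (act θ t T x) := by
  induction x using Omega.induct with
  | hs c => rw [AlgHom.commutes, act, twistedDer_algebraMap, map_zero]
  | hg x =>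
    rw [gradeSign_gen, map_smul, act_gen]
    cases x with
    | psi a => simp [(QC_actGen θ t T (.psi a)).2 rfl, Gen.deg]
    | psiS a => simp [(QC_actGen θ t T (.psiS a)).2 rfl, Gen.deg]
    | dpsi a =>
      have h := d_gradeSign θ (actGen θ t T (.psi a))
      rw [(QC_actGen θ t T (.psi a)).2 rfl] at h
      have h' : actGen θ t T (.dpsi a) = d θ (actGen θ t T (.psi a)) := rfl
      rw [h']; nth_rewrite 1 [h]
      simp [Gen.deg]
    | dpsiS a =>
      have h := d_gradeSign θ (actGen θ t T (.psiS a))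
      rw [(QC_actGen θ t T (.psiS a)).2 rfl] at h
      have h' : actGen θ t T (.dpsiS a) = d θ (actGen θ t T (.psiS a)) := rfl
      rw [h']; nth_rewrite 1 [h]
      simp [Gen.deg]
  | hm x y hx hy => simp only [map_mul, act_mul, map_add, hx, hy, torus_gradeSign]
  | ha x y hx hy => simp only [map_add, hx, hy]

/-- The twisted action commutes with the differential. -/
lemma act_d (θ t : ℝ) (T : ConfGen) (x : Omega θ) : act θ t T (d θ x) = d θ (act θ t T x) := by
  induction x using Omega.induct with
  | hs c => rw [d, twistedDer_algebraMap, map_zero, act, twistedDer_algebraMap, map_zero]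
  | hg x =>
    rw [d_gen, act_gen]
    cases x with
    | psi a => exact act_gen ..
    | psiS a => exact act_gen ..
    | dpsi a => simp only [dGen, map_zero, actGen, d_d]
    | dpsiS a => simp only [dGen, map_zero, actGen, d_d]
  | hm x y hx hy =>
    simp only [d_mul, map_add, act_mul, hx, hy, torus_d, torus_gradeSign, act_gradeSign]
    abel
  | ha x y hx hy => simp only [map_add, hx, hy]

end ThetaSphere

end

open ThetaSphere

noncomputable section

namespace ThetaSphere

/-! ## The entries of `Ψ` and `Ψ^*` -/

/-! The second column of `Ψ` is `σψ*`, and the second row of `Ψ*` is the transpose of `σψ`. Passing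
from `ψ` to `ψ*` reverses torus weights, and so does the permutation underlying `σ`. Hence every
entry in row `a` of `Ψ` has weight `(h1 a, h2 a)`, every entry in column `a` of `Ψ*` has the
opposite weight, and one formula covers both values of the remaining index.

Two matrix facts give the action. Since `σ² = -1`, letting `T` act by `σΓσ⁻¹` on `ψ*` is the same as
`TΨ = ΓΨ` on both columns (`act_Psi`). Charge conjugation, `σγσ⁻¹ = γᵀ` up to a phase depending on
the row, turns the action on `Ψ*` into right multiplication by `γ` (`act_PsiS`): `T` sends column
`a` of `Ψ*` to `½ λ^{-R_a} (-z Ψ* + Ψ*γ)_a`, where `R_a`, `L_a` are the values of `R_T`, `L_T` on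
the weight of `ψ_a`.

The twisted Leibniz rule splits `T(Ψ* dΨ)` into two sums. In the first, the right leg acts on `dΨ`
by `λ^{R_a}`, leaving `½(-zω + Ψ*γ dΨ)`. In the second, moving `z` or `dz` to the left of `Ψ*`
produces `λ^{r_1 h2 a - r_2 h1 a}`, which cancels `λ^{R_a - L_a}`; the result is `½(-dz Ψ*Ψ - zω +
Ψ*γ dΨ)`. Only `R_T - L_T = r_2 H_1 - r_1 H_2` enters this cancellation, so `t` disappears. Adding
the halves and using `Ψ*Ψ = 1` gives the formula (`omega_map_act`). The entries of `ω` have total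
weight zero, so the coordinate may equally stand on the right, as needed for the negative roots. -/

lemma Psi_zero (θ : ℝ) (a : Fin 4) : Psi θ a 0 = gen θ (.psi a) := by
  fin_cases a <;> rfl

/-- This is the column `σψ*`. The sign is taken at `flip a` because `flipSign` records the sign by
the column of `σ` that holds the entry. -/
lemma Psi_one (θ : ℝ) (a : Fin 4) :
    Psi θ a 1 = flipSign (flip a) • gen θ (.psiS (flip a)) := by
  fin_cases a <;> simp [Psi, flip, flipSign]

lemma PsiS_zero (θ : ℝ) (a : Fin 4) : PsiS θ 0 a = gen θ (.psiS a) := by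
  fin_cases a <;> rfl

lemma PsiS_one (θ : ℝ) (a : Fin 4) :
    PsiS θ 1 a = flipSign (flip a) • gen θ (.psi (flip a)) := by
  fin_cases a <;> simp [PsiS, flip, flipSign]

lemma sum_flip {M : Type*} [AddCommMonoid M] (f : Fin 4 → M) : ∑ a, f (flip a) = ∑ a, f a :=
  Equiv.sum_comp (⟨flip, flip, flip_flip, flip_flip⟩ : Equiv.Perm (Fin 4)) f

/-- Charge conjugation, solved for `σγσ⁻¹` by inverting the phase in `dirac_flip`. -/
lemma dirac_unflip (θ : ℝ) (T : ConfGen) (a b : Fin 4) :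
    flipSign a * flipSign b * T.dirac θ (flip a) (flip b) =
      lam θ (T.root.1 * h2 a - T.root.2 * h1 a) * T.dirac θ b a := by
  rw [← dirac_flip θ T a b, mul_left_comm, ← lam_add]
  simp [lam_zero]

/-! ### Torus weights and commutation phases of the entries -/

lemma torus_PsiS (θ u v : ℝ) (i : Fin 2) (a : Fin 4) :
    torus θ u v (PsiS θ i a) = lam θ (-(u * h1 a + v * h2 a)) • PsiS θ i a := by
  fin_cases i
  · simp [PsiS_zero, torus_gen, Gen.sgn, Gen.idx]
  · simp only [Fin.mk_one, PsiS_one, map_smul, torus_gen, Gen.sgn, Gen.idx, h1_flip, h2_flip]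
    rw [smul_comm]
    congr 2; ring

lemma torus_Psi (θ u v : ℝ) (a : Fin 4) (j : Fin 2) :
    torus θ u v (Psi θ a j) = lam θ (u * h1 a + v * h2 a) • Psi θ a j := by
  fin_cases j
  · simp [Psi_zero, torus_gen, Gen.sgn, Gen.idx]
  · simp only [Fin.mk_one, Psi_one, map_smul, torus_gen, Gen.sgn, Gen.idx, h1_flip, h2_flip]
    rw [smul_comm]
    congr 2; ring

/-- The entries of `Ψ*` have degree zero, so no sign arises whatever `p` is. The coordinate and its
differential therefore pick up the same phase. -/
lemma PsiS_mul_of_QC {θ r s : ℝ} {p : ℕ} {A : Omega θ} (hA : QC θ r s p A) (i : Fin 2)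
    (a : Fin 4) : PsiS θ i a * A = lam θ (h2 a * r - h1 a * s) • (A * PsiS θ i a) := by
  fin_cases i
  · simp only [Fin.zero_eta, PsiS_zero, hA (.psiS a), Gen.deg, Gen.w1, Gen.w2, Gen.sgn, Gen.idx]
    rw [zero_mul, pow_zero, one_mul]
    congr 2; ring
  · simp only [Fin.mk_one, PsiS_one, smul_mul_assoc, mul_smul_comm, hA (.psi (flip a)), Gen.deg,
      Gen.w1, Gen.w2, Gen.sgn, Gen.idx, h1_flip, h2_flip]
    rw [smul_comm, zero_mul, pow_zero, one_mul]
    congr 2; ring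

lemma dPsi_mul_of_QC {θ r s : ℝ} {A : Omega θ} (hA : QC θ r s 0 A) (a : Fin 4) (j : Fin 2) :
    dPsi θ a j * A = lam θ (h1 a * s - h2 a * r) • (A * dPsi θ a j) := by
  fin_cases j
  · simp only [Fin.zero_eta, dPsi, Matrix.map_apply, Psi_zero, d_gen, dGen, hA (.dpsi a),
      Gen.w1, Gen.w2, Gen.sgn, Gen.idx]
    rw [mul_zero, pow_zero, one_mul]
    congr 2; ring
  · simp only [Fin.mk_one, dPsi, Matrix.map_apply, Psi_one, map_smul, d_gen, dGen,
      smul_mul_assoc, mul_smul_comm, hA (.dpsiS (flip a)), Gen.w1, Gen.w2, Gen.sgn, Gen.idx,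
      h1_flip, h2_flip]
    rw [smul_comm, mul_zero, pow_zero, one_mul]
    congr 2; ring

/-- The columns of `Ψ` are orthonormal. -/
lemma PsiS_mul_Psi (θ : ℝ) : PsiS θ * Psi θ = 1 := by
  -- The weights of `ψ_a` and `ψ_a^*` are opposite, so their commutation phase is trivial.
  have hs : ∀ a, gen θ (.psi a) * gen θ (.psiS a) = gen θ (.psiS a) * gen θ (.psi a) := by
    intro a
    rw [gen_comm]
    fin_cases a <;> simp [comCoeff, Gen.deg, Gen.sgn, Gen.idx, thetaM, lam_zero]
  -- Labels exchanged by `flip` have opposite weights, so such generators commute and the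
  -- off-diagonal entries cancel in pairs. One factor of degree zero already removes the sign.
  have h01 : ∀ x y : Gen, x.deg = 0 → thetaM x.idx y.idx = 0 →
      gen θ x * gen θ y = gen θ y * gen θ x := by
    intro x y hx hxy
    rw [gen_comm, comCoeff, hx, hxy]
    simp [lam_zero]
  have hS := gen_sphere θ
  ext i j
  fin_cases i <;> fin_cases j
  · simpa [Matrix.mul_apply, PsiS_zero, Psi_zero] using hS
  · simp [Matrix.mul_apply, Fin.sum_univ_four, PsiS, Psi,
      h01 (.psiS 0) (.psiS 1) rfl (by simp [Gen.idx, thetaM]),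
      h01 (.psiS 2) (.psiS 3) rfl (by simp [Gen.idx, thetaM])]
  · simp [Matrix.mul_apply, Fin.sum_univ_four, PsiS, Psi,
      h01 (.psi 0) (.psi 1) rfl (by simp [Gen.idx, thetaM]),
      h01 (.psi 2) (.psi 3) rfl (by simp [Gen.idx, thetaM])]
  · simp only [Fin.mk_one, Matrix.mul_apply, PsiS_one, Psi_one, smul_mul_smul_comm,
      flipSign_mul_self, one_smul, Matrix.one_apply_eq]
    rw [sum_flip fun a => gen θ (.psi a) * gen θ (.psiS a)]
    simpa only [hs] using hS

/-! ## The action on `Ψ`, `Ψ^*` and on the gauge potential -/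

/-- On the second column, `σ(σΓσ⁻¹)ψ* = Γσψ*` because `σ⁻¹ = -σ`. In components the two factors of
`σ` undo each other through `flip_flip` and `flipSign_mul_self`. -/
lemma act_Psi (θ t : ℝ) (T : ConfGen) (a : Fin 4) (j : Fin 2) : act θ t T (Psi θ a j) =
    (-(1 / 2) * lam θ ((T.legR t).1 * h1 a + (T.legR t).2 * h2 a)) • (T.coord θ * Psi θ a j) +
    ∑ b, (1 / 2 * (lam θ ((T.legL t).1 * h1 a + (T.legL t).2 * h2 a) * T.dirac θ a b)) •
      Psi θ b j := by
  fin_cases j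
  · simp only [Fin.zero_eta, Psi_zero, act_gen, actGen_psi]
  · simp only [Fin.mk_one, Psi_one, map_smul, act_gen, actGen_psiS, h1_flip, h2_flip, smul_add,
      mul_smul_comm, flip_flip, Finset.smul_sum]
    rw [← sum_flip]
    congr 1
    · rw [smul_comm]
      congr 3; ring_nf
    · refine Finset.sum_congr rfl fun b _ => ?_
      rw [flip_flip, smul_smul, smul_smul]
      congr 1
      rw [show -((T.legL t).1 * -h1 a + (T.legL t).2 * -h2 a) =
        (T.legL t).1 * h1 a + (T.legL t).2 * h2 a by ring]
      linear_combination (1 / 2 * lam θ ((T.legL t).1 * h1 a + (T.legL t).2 * h2 a) *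
        flipSign (flip b) * T.dirac θ a b) * flipSign_mul_self (flip a)

/-- Charge conjugation transposes `γ`, and its phase converts `λ^{-L_a}` into `λ^{-R_a}`. Both terms
then carry the one phase that the right leg of the coproduct cancels. -/
lemma act_PsiS (θ t : ℝ) (T : ConfGen) (i : Fin 2) (a : Fin 4) : act θ t T (PsiS θ i a) =
    (-(1 / 2) * lam θ (-((T.legR t).1 * h1 a + (T.legR t).2 * h2 a))) •
      (T.coord θ * PsiS θ i a) +
    ∑ b, (1 / 2 * (lam θ (-((T.legR t).1 * h1 a + (T.legR t).2 * h2 a)) * T.dirac θ b a)) •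
      PsiS θ i b := by
  have hl : lam θ (-((T.legR t).1 * h1 a + (T.legR t).2 * h2 a)) =
      lam θ (-((T.legL t).1 * h1 a + (T.legL t).2 * h2 a)) *
        lam θ (T.root.1 * h2 a - T.root.2 * h1 a) := by
    rw [← lam_add]
    congr 1
    simp only [ConfGen.legL, ConfGen.legR]
    ring
  fin_cases i
  · simp only [Fin.zero_eta, PsiS_zero, act_gen, actGen_psiS]
    congr 1
    refine Finset.sum_congr rfl fun b _ => ?_
    rw [dirac_unflip, hl, mul_assoc (lam θ _)]
  · simp only [Fin.mk_one, PsiS_one, map_smul, act_gen, actGen_psi, h1_flip, h2_flip, smul_add,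
      mul_smul_comm, Finset.smul_sum]
    rw [← sum_flip]
    congr 1
    · rw [smul_comm]
      congr 3; ring_nf
    · refine Finset.sum_congr rfl fun b _ => ?_
      rw [smul_smul, smul_smul]
      congr 1
      -- Antisymmetry of `σ`; the two resulting minus signs cancel, so `dirac_unflip` applies at
      -- `a`, `b` themselves.
      have hf : ∀ c, flipSign (flip c) = -flipSign c := by
        intro c; fin_cases c <;> simp [flip, flipSign]
      have h := dirac_unflip θ T a b
      rw [hl, hf, hf, show (T.legL t).1 * -h1 a + (T.legL t).2 * -h2 a =
        -((T.legL t).1 * h1 a + (T.legL t).2 * h2 a) by ring]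
      linear_combination (-(1 / 2) * lam θ (-((T.legL t).1 * h1 a + (T.legL t).2 * h2 a)) *
        flipSign b) * h + (1 / 2 * lam θ (-((T.legL t).1 * h1 a + (T.legL t).2 * h2 a)) *
        flipSign a * T.dirac θ (flip a) (flip b)) * flipSign_mul_self b

/-! ### Assembling the two halves of the Leibniz rule -/

lemma PsiS_mul_toOmega_mul_dPsi (θ : ℝ) (A : Matrix (Fin 4) (Fin 4) ℂ) (i j : Fin 2) :
    (PsiS θ * toOmega θ A * dPsi θ) i j =
      ∑ a, ∑ b, A a b • (PsiS θ i a * dPsi θ b j) := by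
  simp only [Matrix.mul_apply, toOmega, Matrix.map_apply, Finset.sum_mul]
  rw [Finset.sum_comm]
  refine Finset.sum_congr rfl fun a _ => Finset.sum_congr rfl fun b _ => ?_
  rw [← Algebra.commutes, mul_assoc, ← Algebra.smul_def]

/-- The entries of the gauge potential commute with forms of degree zero and given weight. -/
lemma omega_mul_of_QC {θ r s : ℝ} {A : Omega θ} (hA : QC θ r s 0 A) (i j : Fin 2) :
    omega θ i j * A = A * omega θ i j := by
  simp only [omega, Matrix.mul_apply, Finset.sum_mul, Finset.mul_sum]
  refine Finset.sum_congr rfl fun a _ => ?_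
  -- The phases from passing `dΨ` and `Ψ*` in the same term are inverse to each other.
  rw [mul_assoc, dPsi_mul_of_QC hA, mul_smul_comm, ← mul_assoc, PsiS_mul_of_QC hA,
    smul_mul_assoc, smul_smul, ← lam_add, mul_assoc]
  simp [lam_zero]

lemma act_PsiS_mul_torus_dPsi (θ t : ℝ) (T : ConfGen) (i j : Fin 2) :
    ∑ a, act θ t T (PsiS θ i a) * torus θ (T.legR t).1 (T.legR t).2 (dPsi θ a j) =
      -(1 / 2 : ℂ) • (T.coord θ * omega θ i j) +
        (1 / 2 : ℂ) • (PsiS θ * toOmega θ (T.dirac θ) * dPsi θ) i j := by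
  -- After the exchange the outer index is the row of `dΨ`, so the identity can be checked for each
  -- such row.
  rw [PsiS_mul_toOmega_mul_dPsi, Finset.sum_comm, omega, Matrix.mul_apply, Finset.mul_sum,
    Finset.smul_sum, Finset.smul_sum, ← Finset.sum_add_distrib]
  refine Finset.sum_congr rfl fun a _ => ?_
  have hl := lam_add θ (-((T.legR t).1 * h1 a + (T.legR t).2 * h2 a))
    ((T.legR t).1 * h1 a + (T.legR t).2 * h2 a)
  rw [neg_add_cancel, lam_zero] at hl
  rw [act_PsiS, dPsi, Matrix.map_apply, torus_d, torus_Psi, map_smul, mul_smul_comm, add_mul,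
    smul_add, smul_mul_assoc, smul_smul, mul_assoc (T.coord θ), Finset.sum_mul, Finset.smul_sum,
    Finset.smul_sum]
  congr 1
  · congr 1
    linear_combination (1 / 2) * hl
  · refine Finset.sum_congr rfl fun b _ => ?_
    rw [smul_mul_assoc, smul_smul, smul_smul]
    congr 1
    linear_combination (-(1 / 2) * T.dirac θ b a) * hl

lemma torus_PsiS_mul_d_act_Psi (θ t : ℝ) (T : ConfGen) (i j : Fin 2) :
    ∑ a, torus θ (T.legL t).1 (T.legL t).2 (PsiS θ i a) * d θ (act θ t T (Psi θ a j)) =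
      -(1 / 2 : ℂ) • (d θ (T.coord θ) * (PsiS θ * Psi θ) i j) +
        -(1 / 2 : ℂ) • (T.coord θ * omega θ i j) +
        (1 / 2 : ℂ) • (PsiS θ * toOmega θ (T.dirac θ) * dPsi θ) i j := by
  rw [PsiS_mul_toOmega_mul_dPsi, omega, Matrix.mul_apply, Matrix.mul_apply, Finset.mul_sum,
    Finset.mul_sum, Finset.smul_sum, Finset.smul_sum, Finset.smul_sum, ← Finset.sum_add_distrib,
    ← Finset.sum_add_distrib]
  refine Finset.sum_congr rfl fun a _ => ?_
  have hl := lam_add θ (-((T.legL t).1 * h1 a + (T.legL t).2 * h2 a))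
    ((T.legL t).1 * h1 a + (T.legL t).2 * h2 a)
  rw [neg_add_cancel, lam_zero] at hl
  -- The three phases come from the left leg acting on `Ψ*`, from the coordinate term of `Γ`, and
  -- from moving `z` or `dz` past `Ψ*`; their exponents sum to zero for every `t`.
  have hr : lam θ (-((T.legL t).1 * h1 a + (T.legL t).2 * h2 a)) *
      (-(1 / 2) * lam θ ((T.legR t).1 * h1 a + (T.legR t).2 * h2 a)) *
      lam θ (h2 a * T.root.1 - h1 a * T.root.2) = -(1 / 2) := by
    rw [mul_left_comm, mul_assoc, ← lam_add, ← lam_add]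
    refine (congrArg (fun x => -(1 / 2) * lam θ x) (?_ : _ = (0 : ℝ))).trans (by simp [lam_zero])
    simp only [ConfGen.legL, ConfGen.legR]
    ring
  rw [torus_PsiS, act_Psi, map_add, map_smul, d_mul, gradeSign_coord, smul_add, mul_add, mul_add,
    smul_mul_smul_comm, smul_mul_smul_comm, ← mul_assoc (PsiS θ i a),
    ← mul_assoc (PsiS θ i a), PsiS_mul_of_QC ((QC_coord θ T).d (gradeSign_coord θ T)),
    PsiS_mul_of_QC (QC_coord θ T), smul_mul_assoc, smul_mul_assoc, smul_smul, smul_smul, hr,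
    mul_assoc, mul_assoc, map_sum, smul_mul_assoc, Finset.mul_sum, Finset.smul_sum,
    Finset.smul_sum]
  congr 1
  refine Finset.sum_congr rfl fun b _ => ?_
  rw [map_smul, mul_smul_comm, smul_smul, smul_smul]
  change _ • (PsiS θ i a * dPsi θ b j) = _
  congr 1
  linear_combination (-(1 / 2) * T.dirac θ a b) * hl

/-- The infinitesimal transformation of the instanton gauge potential. -/
lemma omega_map_act (θ t : ℝ) (T : ConfGen) : (omega θ).map (act θ t T) =
    -(T.coord θ • omega θ) - (1 / 2 : ℂ) • Matrix.diagonal (fun _ => d θ (T.coord θ)) +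
      PsiS θ * toOmega θ (T.dirac θ) * dPsi θ := by
  ext i j
  have h : act θ t T (omega θ i j) =
      ∑ a, act θ t T (PsiS θ i a) * torus θ (T.legR t).1 (T.legR t).2 (dPsi θ a j) +
      ∑ a, torus θ (T.legL t).1 (T.legL t).2 (PsiS θ i a) * d θ (act θ t T (Psi θ a j)) := by
    rw [omega, Matrix.mul_apply, map_sum, ← Finset.sum_add_distrib]
    refine Finset.sum_congr rfl fun a _ => ?_
    rw [act_mul, dPsi, Matrix.map_apply, act_d]
  rw [Matrix.map_apply, h, act_PsiS_mul_torus_dPsi, torus_PsiS_mul_d_act_Psi, PsiS_mul_Psi]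
  simp only [Matrix.add_apply, Matrix.sub_apply, Matrix.neg_apply, Matrix.smul_apply,
    smul_eq_mul, Matrix.one_apply, Matrix.diagonal_apply, mul_ite, mul_one, mul_zero]
  -- The two copies of `½(-zω + Ψ*γ dΨ)` merge here.
  module

/-- The same formula with the coordinate on the right of the gauge potential. -/
lemma omega_map_act_right (θ t : ℝ) (T : ConfGen) : (omega θ).map (act θ t T) =
    -(omega θ).map (fun α => α * T.coord θ) -
      (1 / 2 : ℂ) • Matrix.diagonal (fun _ => d θ (T.coord θ)) +
      PsiS θ * toOmega θ (T.dirac θ) * dPsi θ := by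
  have h : (omega θ).map (fun α => α * T.coord θ) = T.coord θ • omega θ := by
    ext i j
    exact omega_mul_of_QC (QC_coord θ T) i j
  rw [omega_map_act, h]

end ThetaSphere

end

theorem mainTheorem6 (θ t : ℝ) :
    (omega θ).map (act θ t .H0) =
        -(z θ 0 • omega θ) - (1 / 2 : ℂ) • Matrix.diagonal (fun _ => d θ (z θ 0)) +
          PsiS θ * toOmega θ (gamma θ 0) * dPsi θ ∧
      (omega θ).map (act θ t .Gp1) =
        -(z θ 1 • omega θ) - (1 / 2 : ℂ) • Matrix.diagonal (fun _ => d θ (z θ 1)) +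
          PsiS θ * toOmega θ (gamma θ 1) * dPsi θ ∧
      (omega θ).map (act θ t .Gp2) =
        -(z θ 2 • omega θ) - (1 / 2 : ℂ) • Matrix.diagonal (fun _ => d θ (z θ 2)) +
          PsiS θ * toOmega θ (gamma θ 2) * dPsi θ ∧
      (omega θ).map (act θ t .Gm1) =
        -(omega θ).map (fun α => α * zS θ 1) -
            (1 / 2 : ℂ) • Matrix.diagonal (fun _ => d θ (zS θ 1)) +
          PsiS θ * toOmega θ (gamma θ 1)ᴴ * dPsi θ ∧
      (omega θ).map (act θ t .Gm2) =
        -(omega θ).map (fun α => α * zS θ 2) -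
            (1 / 2 : ℂ) • Matrix.diagonal (fun _ => d θ (zS θ 2)) +
          PsiS θ * toOmega θ (gamma θ 2)ᴴ * dPsi θ :=
  ⟨omega_map_act θ t .H0, omega_map_act θ t .Gp1, omega_map_act θ t .Gp2,
    omega_map_act_right θ t .Gm1, omega_map_act_right θ t .Gm2⟩
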